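/- For $x\in\mathbb R^n$ let $\|x\|$ be the Euclidean norm, let $\|x\|_0$ be the number of nonzero entries of $x$ ($x$ is $k$-sparse if $\|x\|_0\le k$), and let $|x|_{[1]}\ge |x|_{[2]}\ge\dots\ge|x|_{[n]}$ be the numbers $|x_1|,\dots,|x_n|$ in decreasing order. For $A\in\mathbb R^{m\times n}$ and an integer $k\ge1$ let $\delta_k^A$ be the smallest number $\delta$ such that $(1-\delta)\|x\|^2\le\|Ax\|^2\le(1+\delta)\|x\|^2$ for all $k$-sparse $x\in\mathbb R^n$; for real $k>0$ put $\delta_k^A=\delta_{\lceil k\rceil}^A$, and (for completeness) $\delta_0^A=0$. Let $A\in\mathbb R^{m\times n}$, $b\in\mathbb R^m$, suppose that $Ax=b$ is solvable, and let $K=\min\{\|x\|_0: Ax=b\}$. Let $q\in(0,1]$ and let $r$ be an integer with $0\le r\le K$. Assume that (a) $\delta^A_{K-\lfloor r/2\rfloor}<\frac13$ and $(K,r,q)\ne(1,0,1)$, or (b) $\delta^A_{\gamma(K-\lfloor r/2\rfloor)}<\dfrac{1}{\sqrt{(\gamma-1)^{1-2/q}+1}}$ for some real $\gamma>1$. Then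 every sparsest solution $x^*$ of $Ax=b$ (i.e. $Ax^*=b$ and $\|x^*\|_0=K$) is a strict local minimizer of $$\min_{x\in\mathbb R^n}\Big\{\sum_{i=r+1}^n |x|_{[i]}^q:\ Ax=b\Big\},$$ that is, there is $\varepsilon>0$ such that $\sum_{i=r+1}^n |x|_{[i]}^q>\sum_{i=r+1}^n|x^*|_{[i]}^q$ for all $x\neq x^*$ with $Ax=b$ and $\|x-x^*\|<\varepsilon$. Moreover, the bounds on the restricted isometry constants in (a) and (b) are weaker than the corresponding bounds with $r=0$: $\delta^A_K<\frac13$ implies $\delta^A_{K-\lfloor r/2\rfloor}<\frac13$, and for every $\gamma>1$, $\delta^A_{\gamma K}<\frac{1}{\sqrt{(\gamma-1)^{1-2/q}+1}}$ implies $\delta^A_{\gamma(K-\lfloor r/2\rfloor)}<\frac{1}{\sqrt{(\gamma-1)^{1-2/q}+1}}$. -/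

import Mathlib

noncomputable section

namespace PartialReg

/-- `‖x‖₀`: the number of nonzero entries of `x`. -/
def zeroNorm {n : ℕ} (x : EuclideanSpace ℝ (Fin n)) : ℕ :=
  (Finset.univ.filter fun i => x i ≠ 0).card

/-- The numbers `δ` such that `(1 - δ)‖x‖² ≤ ‖A x‖² ≤ (1 + δ)‖x‖²` for all `k`-sparse `x`. -/
def ricBounds {m n : ℕ} (A : Matrix (Fin m) (Fin n) ℝ) (k : ℕ) : Set ℝ :=
  {δ | ∀ x : EuclideanSpace ℝ (Fin n), zeroNorm x ≤ k →
    (1 - δ) * ‖x‖ ^ 2 ≤ ‖A.toEuclideanLin x‖ ^ 2 ∧ ‖A.toEuclideanLin x‖ ^ 2 ≤ (1 + δ) * ‖x‖ ^ 2}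

/-- The restricted isometry constant `δ_k^A` of real order `k`: the smallest element of
`ricBounds A ⌈k⌉` (see `isLeast_ric`). -/
def ric {m n : ℕ} (A : Matrix (Fin m) (Fin n) ℝ) (k : ℝ) : ℝ :=
  sInf (ricBounds A ⌈k⌉₊)

/-- `absOrd x i` is the entry of rank `i` of `(|x₁|, …, |xₙ|)` in decreasing order; ranks are
counted from `0`, so that `absOrd x i` is `|x|_[i+1]`. -/
def absOrd {n : ℕ} (x : EuclideanSpace ℝ (Fin n)) (i : Fin n) : ℝ :=
  |x (Tuple.sort (fun j => -|x j|) i)|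

/-- `∑_{i=r+1}^n φ(|x|_[i])`. -/
def partialReg {n : ℕ} (φ : ℝ → ℝ) (r : ℕ) (x : EuclideanSpace ℝ (Fin n)) : ℝ :=
  ∑ i : Fin n with r ≤ i.val, φ (absOrd x i)

/-- `K = min {‖x‖₀ : A x = b}`. -/
def minCard {m n : ℕ} (A : Matrix (Fin m) (Fin n) ℝ) (b : EuclideanSpace ℝ (Fin m)) : ℕ :=
  sInf {k | ∃ x, A.toEuclideanLin x = b ∧ zeroNorm x = k}

/-- `x` is a sparsest solution of `A x = b`. -/
def IsSparsest {m n : ℕ} (A : Matrix (Fin m) (Fin n) ℝ) (b : EuclideanSpace ℝ (Fin m))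
    (x : EuclideanSpace ℝ (Fin n)) : Prop :=
  A.toEuclideanLin x = b ∧ ∀ y, A.toEuclideanLin y = b → zeroNorm x ≤ zeroNorm y

/-- `x` is a strict local minimizer of `min {∑_{i=r+1}^n φ(|x|_[i]) : A x = b}`. -/
def IsStrictLocalMinimizer {m n : ℕ} (A : Matrix (Fin m) (Fin n) ℝ)
    (b : EuclideanSpace ℝ (Fin m)) (φ : ℝ → ℝ) (r : ℕ) (x : EuclideanSpace ℝ (Fin n)) : Prop :=
  A.toEuclideanLin x = b ∧
    ∃ ε > 0, ∀ y, A.toEuclideanLin y = b → y ≠ x → ‖y - x‖ < ε → partialReg φ r x < partialReg φ r y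

theorem antitone_absOrd {n : ℕ} (x : EuclideanSpace ℝ (Fin n)) : Antitone (absOrd x) := by
  intro i j hij
  have h := Tuple.monotone_sort (fun j => -|x j|) hij
  simpa [absOrd] using h

/-- For positive order (and `n ≥ 1`) the restricted isometry constant is a genuine minimum. -/
theorem isLeast_ric {m n : ℕ} (hn : 0 < n) (A : Matrix (Fin m) (Fin n) ℝ) {k : ℝ} (hk : 0 < k) :
    IsLeast (ricBounds A ⌈k⌉₊) (ric A k) := by
  have hclosed : IsClosed (ricBounds A ⌈k⌉₊) := by
    have : ricBounds A ⌈k⌉₊ = ⋂ x : EuclideanSpace ℝ (Fin n), ⋂ _ : zeroNorm x ≤ ⌈k⌉₊,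
        {δ : ℝ | (1 - δ) * ‖x‖ ^ 2 ≤ ‖A.toEuclideanLin x‖ ^ 2} ∩
        {δ : ℝ | ‖A.toEuclideanLin x‖ ^ 2 ≤ (1 + δ) * ‖x‖ ^ 2} := by
      ext δ; simp [ricBounds]
    rw [this]
    refine isClosed_iInter fun x => isClosed_iInter fun _ => ?_
    exact (isClosed_le (by fun_prop) (by fun_prop)).inter (isClosed_le (by fun_prop) (by fun_prop))
  have hbdd : BddBelow (ricBounds A ⌈k⌉₊) := by
    refine ⟨0, fun δ hδ => ?_⟩
    have h := hδ (EuclideanSpace.single ⟨0, hn⟩ 1) (by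
      refine le_trans ?_ (Nat.one_le_iff_ne_zero.mpr (Nat.ceil_pos.mpr hk).ne')
      refine (Finset.card_le_one).mpr ?_
      intro a ha c hc
      simp at ha hc
      rw [ha, hc])
    have h1 := h.1.trans h.2
    simp at h1
    linarith
  have hne : (ricBounds A ⌈k⌉₊).Nonempty := by
    let L : EuclideanSpace ℝ (Fin n) →L[ℝ] EuclideanSpace ℝ (Fin m) :=
      LinearMap.toContinuousLinearMap A.toEuclideanLin
    have hL : ∀ x, ‖A.toEuclideanLin x‖ ≤ ‖L‖ * ‖x‖ := fun x => L.le_opNorm x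
    refine ⟨1 + ‖L‖ ^ 2, fun x _ => ⟨?_, ?_⟩⟩
    · nlinarith [sq_nonneg ‖A.toEuclideanLin x‖, mul_nonneg (sq_nonneg ‖L‖) (sq_nonneg ‖x‖)]
    · have := pow_le_pow_left₀ (norm_nonneg _) (hL x) 2
      nlinarith [sq_nonneg ‖x‖]
  exact hclosed.isLeast_csInf hne hbdd

end PartialReg

end

/-! Let `S` be the support of a sparsest solution `x`. Near `x`, the `r` largest entries of a
feasible `y` sit in some `T ⊆ S`, so with `h = y - x` in the kernel of `A` the change of the
objective is at least a sum over `S \ T` plus `∑_{Sᶜ} |h i| ^ q` (`exists_partialReg_sub_ge`).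

For `q < 1` no isometry condition is needed. By minimality of the support, the mass of a kernel
vector on `S` is at most a constant times its mass on `Sᶜ`; the loss on `S \ T` is linear in `|h
i|`, while `|h i| ^ q` has infinite slope at `0` and dominates.

For `q = 1` the gain must exceed the loss: `∑_{S \ T} |h i| < ∑_{Sᶜ} |h i|`. If `r = K`, the left
side is empty. Otherwise the null space property of order `K - ⌊r/2⌋` suffices, because the small
half of `T` can be traded against the large half (`sum_sdiff_lt_of_nsp`). That property follows from
(a) by `sum_abs_lt_sum_compl_of_lt_third` and from (b) by `sum_abs_lt_sum_compl_of_lt_sqrt`. Both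
replace the flat tail of a kernel vector by a sparse vector (`exists_sparse_le`) and compare two
restricted isometry inequalities. -/

namespace PartialReg

/-! ### Subsets carrying large or small values -/

/-- Every finite set has a subset of prescribed size on which `f` takes its largest values. -/
theorem exists_subset_card_eq_forall_le {ι : Type*} [DecidableEq ι] (f : ι → ℝ) (S : Finset ι)
    {a : ℕ} (ha : a ≤ S.card) :
    ∃ T ⊆ S, T.card = a ∧ ∀ i ∈ T, ∀ j ∈ S \ T, f j ≤ f i := by
  induction a with
  | zero => exact ⟨∅, by simp, by simp, by simp⟩
  | succ a ih =>
    obtain ⟨T, hTS, hTa, hT⟩ := ih (by omega)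
    have hne : (S \ T).Nonempty := by
      rw [← Finset.card_pos, Finset.card_sdiff_of_subset hTS]
      omega
    obtain ⟨p, hp, hpmax⟩ := Finset.exists_max_image (S \ T) f hne
    have hp' := Finset.mem_sdiff.1 hp
    refine ⟨insert p T, Finset.insert_subset hp'.1 hTS, ?_, ?_⟩
    · rw [Finset.card_insert_of_notMem hp'.2, hTa]
    · intro i hi j hj
      simp only [Finset.mem_sdiff, Finset.mem_insert, not_or] at hj
      have hj' : j ∈ S \ T := Finset.mem_sdiff.2 ⟨hj.1, hj.2.2⟩
      rcases Finset.mem_insert.1 hi with rfl | hi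
      · exact hpmax j hj'
      · exact hT i hi j hj'

/-- If the values of `f` on `T` dominate those on `U`, a sum over `U` is at most one over `T`. -/
theorem card_mul_sum_le_card_mul_sum {ι : Type*} (f : ι → ℝ) (T U : Finset ι)
    (h : ∀ i ∈ T, ∀ j ∈ U, f j ≤ f i) :
    (T.card : ℝ) * ∑ j ∈ U, f j ≤ U.card * ∑ i ∈ T, f i := by
  have h1 : ∑ i ∈ T, ∑ j ∈ U, f j ≤ ∑ i ∈ T, ∑ _j ∈ U, f i :=
    Finset.sum_le_sum fun i hi => Finset.sum_le_sum fun j hj => h i hi j hj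
  simpa [Finset.mul_sum] using h1

/-- The sum over a set of size `a` carrying the largest values is maximal. -/
theorem sum_le_sum_of_forall_le {ι : Type*} [DecidableEq ι] (f : ι → ℝ) {T U : Finset ι}
    (hcard : U.card = T.card) (h : ∀ i ∈ T, ∀ j ∉ T, f j ≤ f i) :
    ∑ j ∈ U, f j ≤ ∑ i ∈ T, f i := by
  have hc : (U \ T).card = (T \ U).card := by
    have h1 := Finset.card_sdiff_add_card_inter U T
    have h2 := Finset.card_sdiff_add_card_inter T U
    rw [Finset.inter_comm] at h2
    omega
  have h1 := card_mul_sum_le_card_mul_sum f (T \ U) (U \ T) fun i hi j hj =>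
    h i (Finset.mem_sdiff.1 hi).1 j (Finset.mem_sdiff.1 hj).2
  have hU := Finset.sum_inter_add_sum_sdiff U T f
  have hT := Finset.sum_inter_add_sum_sdiff T U f
  rw [Finset.inter_comm] at hT
  rw [hc] at h1
  rcases Nat.eq_zero_or_pos (T \ U).card with h0 | h0
  · have e1 := Finset.card_eq_zero.1 h0
    have e2 := Finset.card_eq_zero.1 (hc.trans h0)
    rw [e1] at hT
    rw [e2] at hU
    simp only [Finset.sum_empty] at hT hU
    linarith
  · have := le_of_mul_le_mul_left h1 (by exact_mod_cast h0)
    linarith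

/-- Some subset of size `a` has a mean at most that of the whole set. -/
theorem exists_subset_card_eq_sum_le {ι : Type*} [DecidableEq ι] (f : ι → ℝ) (S : Finset ι)
    {a : ℕ} (ha : a ≤ S.card) :
    ∃ T ⊆ S, T.card = a ∧ (S.card : ℝ) * ∑ i ∈ T, f i ≤ a * ∑ i ∈ S, f i := by
  obtain ⟨T, hTS, hTa, hT⟩ := exists_subset_card_eq_forall_le (fun i => -f i) S ha
  refine ⟨T, hTS, hTa, ?_⟩
  have h := card_mul_sum_le_card_mul_sum (fun i => -f i) T (S \ T) hT
  have hc : ((S \ T).card : ℝ) = S.card - a := by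
    rw [Finset.card_sdiff_of_subset hTS, Nat.cast_sub (Finset.card_le_card hTS), hTa]
  have hs := Finset.sum_sdiff (f := f) hTS
  simp only [Finset.sum_neg_distrib] at h
  rw [hc, hTa] at h
  rw [← hs]
  linarith

/-! ### Restrictions and sparse vectors -/

/-- The restriction of `x` to the coordinates in `S`. -/
noncomputable def restrict {n : ℕ} (S : Finset (Fin n)) (x : EuclideanSpace ℝ (Fin n)) :
    EuclideanSpace ℝ (Fin n) :=
  WithLp.toLp 2 fun i => if i ∈ S then x i else 0

variable {n : ℕ}

@[simp] theorem restrict_apply (S : Finset (Fin n)) (x : EuclideanSpace ℝ (Fin n)) (i : Fin n) :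
    restrict S x i = if i ∈ S then x i else 0 := rfl

theorem norm_sq_restrict (S : Finset (Fin n)) (x : EuclideanSpace ℝ (Fin n)) :
    ‖restrict S x‖ ^ 2 = ∑ i ∈ S, x i ^ 2 := by
  simp [EuclideanSpace.real_norm_sq_eq, ite_pow]

theorem restrict_add_restrict_sdiff {S T : Finset (Fin n)} (hTS : T ⊆ S)
    (x : EuclideanSpace ℝ (Fin n)) : restrict T x + restrict (S \ T) x = restrict S x := by
  ext i
  by_cases h : i ∈ T
  · simp [h, hTS h]
  · simp [h]

theorem restrict_add_restrict_compl (S : Finset (Fin n)) (x : EuclideanSpace ℝ (Fin n)) :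
    restrict S x + restrict Sᶜ x = x := by
  ext i
  by_cases h : i ∈ S <;> simp [h]

theorem zeroNorm_le_card {x : EuclideanSpace ℝ (Fin n)} {S : Finset (Fin n)}
    (h : ∀ i ∉ S, x i = 0) : zeroNorm x ≤ S.card := by
  refine Finset.card_le_card fun i hi => ?_
  by_contra hS
  exact (Finset.mem_filter.1 hi).2 (h i hS)

theorem norm_sq_smul_add_smul {u w : EuclideanSpace ℝ (Fin n)} {S D : Finset (Fin n)}
    (hSD : Disjoint S D) (hu : ∀ i ∉ S, u i = 0) (hw : ∀ i ∉ D, w i = 0) (p q : ℝ) :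
    ‖p • u + q • w‖ ^ 2 = p ^ 2 * ‖u‖ ^ 2 + q ^ 2 * ‖w‖ ^ 2 := by
  simp only [EuclideanSpace.real_norm_sq_eq, Finset.mul_sum, ← Finset.sum_add_distrib]
  refine Finset.sum_congr rfl fun i _ => ?_
  have : u i = 0 ∨ w i = 0 := by
    by_cases h : i ∈ S
    · exact Or.inr (hw i (Finset.disjoint_left.1 hSD h))
    · exact Or.inl (hu i h)
  rcases this with h | h <;> simp [h] <;> ring

theorem zeroNorm_smul_add_smul_le {u w : EuclideanSpace ℝ (Fin n)} {S D : Finset (Fin n)}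
    (hu : ∀ i ∉ S, u i = 0) (hw : ∀ i ∉ D, w i = 0) (p q : ℝ) :
    zeroNorm (p • u + q • w) ≤ S.card + D.card := by
  refine (zeroNorm_le_card (S := S ∪ D) fun i hi => ?_).trans (Finset.card_union_le _ _)
  simp only [Finset.mem_union, not_or] at hi
  simp [hu i hi.1, hw i hi.2]

theorem linearMap_eq_sum (φ : EuclideanSpace ℝ (Fin n) →ₗ[ℝ] ℝ) (x : EuclideanSpace ℝ (Fin n)) :
    φ x = ∑ i, x i * φ (EuclideanSpace.single i 1) := by
  conv_lhs => rw [← (EuclideanSpace.basisFun (Fin n) ℝ).sum_repr x]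
  simp

/-! ### Sparse replacement of a flat tail -/

/-- On the polytope `{v : ‖v‖_∞ ≤ β, ‖v‖₁ ≤ s β}` of vectors supported in `E`, a linear functional
is minimized at an `s`-sparse vector. -/
theorem exists_sparse_le (φ : EuclideanSpace ℝ (Fin n) →ₗ[ℝ] ℝ) (v : EuclideanSpace ℝ (Fin n))
    (E : Finset (Fin n)) {β : ℝ} (s : ℕ) (hv : ∀ i ∈ E, |v i| ≤ β)
    (hsum : ∑ i ∈ E, |v i| ≤ s * β) :
    ∃ D ⊆ E, D.card ≤ s ∧ ∃ w : EuclideanSpace ℝ (Fin n), (∀ i ∉ D, w i = 0) ∧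
      ‖w‖ ^ 2 ≤ s * β ^ 2 ∧ φ w ≤ φ (restrict E v) := by
  set c : Fin n → ℝ := fun i => φ (EuclideanSpace.single i 1) with hc
  have hφE : φ (restrict E v) = ∑ i ∈ E, v i * c i := by
    rw [linearMap_eq_sum]
    simp [hc]
  rcases le_or_gt E.card s with hE | hE
  · refine ⟨E, subset_rfl, hE, restrict E v, fun i hi => by simp [hi], ?_, le_rfl⟩
    rw [norm_sq_restrict]
    calc ∑ i ∈ E, v i ^ 2 ≤ ∑ i ∈ E, β ^ 2 := Finset.sum_le_sum fun i hi => by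
          rw [← sq_abs]
          exact pow_le_pow_left₀ (abs_nonneg _) (hv i hi) 2
      _ ≤ s * β ^ 2 := by
          rw [Finset.sum_const, nsmul_eq_mul]
          gcongr
  · obtain ⟨D, hDE, hDs, hD⟩ := exists_subset_card_eq_forall_le (fun i => |c i|) E hE.le
    -- The minimizer spends the whole budget `s β` on the `s` largest coefficients of `φ`, with sign
    -- opposite to each coefficient.
    set w : EuclideanSpace ℝ (Fin n) :=
      restrict D (WithLp.toLp 2 fun i => -(SignType.sign (c i) : ℝ) * β) with hw
    refine ⟨D, hDE, hDs.le, w, fun i hi => by simp [hw, hi], ?_, ?_⟩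
    · rw [hw, norm_sq_restrict]
      calc ∑ i ∈ D, (-(SignType.sign (c i) : ℝ) * β) ^ 2 ≤ ∑ i ∈ D, β ^ 2 := by
            refine Finset.sum_le_sum fun i _ => ?_
            have : (SignType.sign (c i) : ℝ) ^ 2 ≤ 1 := by
              rcases lt_trichotomy (c i) 0 with h | h | h <;> simp [h]
            nlinarith [sq_nonneg β]
        _ = s * β ^ 2 := by rw [Finset.sum_const, nsmul_eq_mul, hDs]
    · have hφw : φ w = -∑ i ∈ D, |c i| * β := by
        rw [hw, linearMap_eq_sum, ← Finset.sum_neg_distrib]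
        simp only [restrict_apply, ite_mul, zero_mul, Finset.sum_ite_mem, Finset.univ_inter]
        refine Finset.sum_congr rfl fun i _ => ?_
        rw [← sign_mul_self (c i)]
        ring
      have hlow : -∑ i ∈ E, |c i| * |v i| ≤ ∑ i ∈ E, v i * c i := by
        rw [← Finset.sum_neg_distrib]
        refine Finset.sum_le_sum fun i _ => ?_
        rw [← abs_mul, mul_comm]
        exact neg_abs_le _
      have hkey : ∑ i ∈ E, |c i| * |v i| ≤ ∑ i ∈ D, |c i| * β := by
        rcases D.eq_empty_or_nonempty with h0 | hne
        · have hs0 : s = 0 := by rw [← hDs, h0]; simp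
          have hz : ∑ i ∈ E, |v i| ≤ 0 := by simpa [hs0] using hsum
          have hz' := (Finset.sum_eq_zero_iff_of_nonneg fun i _ => abs_nonneg (v i)).1
            (le_antisymm hz (Finset.sum_nonneg fun i _ => abs_nonneg (v i)))
          rw [h0, Finset.sum_empty, Finset.sum_eq_zero fun i hi => by rw [hz' i hi, mul_zero]]
        -- The smallest coefficient `|c p|` on `D` is a threshold: mass of `v` outside `D` costs at
        -- most `|c p|` per unit, and the unused capacity `β - |v i|` inside `D` is worth at least
        -- that.
        · obtain ⟨p, hp, hpmin⟩ := Finset.exists_min_image D (fun i => |c i|) hne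
          have hsplit := Finset.sum_sdiff (f := fun i => |v i|) hDE
          rw [← Finset.sum_sdiff hDE]
          have h1 : ∑ i ∈ E \ D, |c i| * |v i| ≤ |c p| * ∑ i ∈ E \ D, |v i| := by
            rw [Finset.mul_sum]
            exact Finset.sum_le_sum fun i hi =>
              mul_le_mul_of_nonneg_right (hD p hp i hi) (abs_nonneg _)
          have h2 : |c p| * ∑ i ∈ D, (β - |v i|) ≤ ∑ i ∈ D, |c i| * (β - |v i|) := by
            rw [Finset.mul_sum]
            exact Finset.sum_le_sum fun i hi =>
              mul_le_mul_of_nonneg_right (hpmin i hi) (sub_nonneg.2 (hv i (hDE hi)))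
          have h3 : ∑ i ∈ E \ D, |v i| ≤ ∑ i ∈ D, (β - |v i|) := by
            rw [Finset.sum_sub_distrib, Finset.sum_const, nsmul_eq_mul, hDs]
            linarith
          have h4 := mul_le_mul_of_nonneg_left h3 (abs_nonneg (c p))
          simp only [mul_sub, Finset.sum_sub_distrib] at h2 h4
          linarith
      rw [hφw, hφE]
      linarith

theorem norm_sq_smul_add_smul_eq {F : Type*} [NormedAddCommGroup F] [InnerProductSpace ℝ F]
    (x y : F) (p q : ℝ) :
    ‖p • x + q • y‖ ^ 2 = p ^ 2 * ‖x‖ ^ 2 + 2 * (p * q) * inner ℝ x y + q ^ 2 * ‖y‖ ^ 2 := by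
  rw [norm_add_sq_real, inner_smul_left, inner_smul_right, norm_smul, norm_smul, mul_pow, mul_pow,
    Real.norm_eq_abs, Real.norm_eq_abs, sq_abs, sq_abs]
  simp
  ring

/-- The restricted isometry inequalities for a combination of two disjointly supported vectors. -/
theorem ricBounds_smul_add_smul {m : ℕ} {A : Matrix (Fin m) (Fin n) ℝ} {N : ℕ} {δ : ℝ}
    (hδ : δ ∈ ricBounds A N) {u w : EuclideanSpace ℝ (Fin n)} {S D : Finset (Fin n)}
    (hSD : Disjoint S D) (hN : S.card + D.card ≤ N) (hu : ∀ i ∉ S, u i = 0)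
    (hw : ∀ i ∉ D, w i = 0) (p q : ℝ) :
    (1 - δ) * (p ^ 2 * ‖u‖ ^ 2 + q ^ 2 * ‖w‖ ^ 2) ≤ p ^ 2 * ‖A.toEuclideanLin u‖ ^ 2 +
        2 * (p * q) * inner ℝ (A.toEuclideanLin u) (A.toEuclideanLin w) +
        q ^ 2 * ‖A.toEuclideanLin w‖ ^ 2 ∧
      p ^ 2 * ‖A.toEuclideanLin u‖ ^ 2 +
        2 * (p * q) * inner ℝ (A.toEuclideanLin u) (A.toEuclideanLin w) +
        q ^ 2 * ‖A.toEuclideanLin w‖ ^ 2 ≤ (1 + δ) * (p ^ 2 * ‖u‖ ^ 2 + q ^ 2 * ‖w‖ ^ 2) := by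
  have h := hδ (p • u + q • w) ((zeroNorm_smul_add_smul_le hu hw p q).trans hN)
  rwa [norm_sq_smul_add_smul hSD hu hw, map_add, map_smul, map_smul,
    norm_sq_smul_add_smul_eq] at h

theorem sq_sum_abs_le (S : Finset (Fin n)) (h : EuclideanSpace ℝ (Fin n)) :
    (∑ i ∈ S, |h i|) ^ 2 ≤ S.card * ‖restrict S h‖ ^ 2 := by
  rw [norm_sq_restrict]
  simpa using sq_sum_le_card_mul_sum_sq (s := S) (f := fun i => |h i|)

theorem sum_abs_pos_of_sum_compl_le {h : EuclideanSpace ℝ (Fin n)} (hne : h ≠ 0)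
    {S : Finset (Fin n)} (hle : ∑ i ∈ Sᶜ, |h i| ≤ ∑ i ∈ S, |h i|) : 0 < ∑ i ∈ S, |h i| := by
  obtain ⟨j, hj⟩ : ∃ j, h j ≠ 0 := by
    by_contra! hc
    exact hne (by ext i; simp [hc i])
  have hpos : 0 < ∑ i, |h i| :=
    Finset.sum_pos' (fun i _ => abs_nonneg _) ⟨j, Finset.mem_univ _, abs_pos.2 hj⟩
  rw [← Finset.sum_add_sum_compl S] at hpos
  linarith

/-! ### Null space property from orders above `k` -/

/-- The null space property of order `k` follows from `δ_{k+l} < √(l / (k + l))`. -/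
theorem sum_abs_lt_sum_compl_of_lt_sqrt {m : ℕ} {A : Matrix (Fin m) (Fin n) ℝ} {k l : ℕ}
    (hk : 0 < k) (hl : 0 < l) {δ σ : ℝ} (hσ : 0 < σ) (hσl : σ ^ 2 * (k + l) = l)
    (hδ : δ ∈ ricBounds A (k + l)) (hδσ : δ < σ) {h : EuclideanSpace ℝ (Fin n)}
    (hAh : A.toEuclideanLin h = 0) (hne : h ≠ 0) {S : Finset (Fin n)} (hS : S.card = k) :
    ∑ i ∈ S, |h i| < ∑ i ∈ Sᶜ, |h i| := by
  by_contra! hle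
  set R : ℝ := ∑ i ∈ S, |h i| with hR
  have hRpos : 0 < R := sum_abs_pos_of_sum_compl_le hne hle
  have hk' : (0 : ℝ) < k := by exact_mod_cast hk
  have hl' : (0 : ℝ) < l := by exact_mod_cast hl
  set β : ℝ := R / l with hβ
  have hβpos : 0 < β := div_pos hRpos hl'
  -- Entries off `S` above `β` are kept in `u`. Each uses `β` of the budget `R = l β`, so what
  -- remains on `E` has height at most `β` and mass at most `(l - |B|) β`.
  set B : Finset (Fin n) := Sᶜ.filter fun i => β < |h i| with hB
  set E : Finset (Fin n) := Sᶜ.filter fun i => ¬ β < |h i| with hE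
  have hsplit : ∑ i ∈ B, |h i| + ∑ i ∈ E, |h i| = ∑ i ∈ Sᶜ, |h i| :=
    Finset.sum_filter_add_sum_filter_not _ _ _
  have hBlow : B.card * β ≤ ∑ i ∈ B, |h i| := by
    rw [← nsmul_eq_mul]
    exact Finset.card_nsmul_le_sum _ _ _ fun i hi => (Finset.mem_filter.1 hi).2.le
  have hEnn : 0 ≤ ∑ i ∈ E, |h i| := Finset.sum_nonneg fun i _ => abs_nonneg _
  have hlβ : l * β = R := by rw [hβ]; field_simp
  have hBl : B.card ≤ l := by
    have : (B.card : ℝ) * β ≤ l * β := by linarith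
    exact_mod_cast le_of_mul_le_mul_right this hβpos
  set u := restrict (S ∪ B) h with hu
  have hSB : Disjoint S B :=
    Finset.disjoint_left.2 fun i hi hi' => by simp [hB, hi] at hi'
  have hcompl : (S ∪ B)ᶜ = E := by
    ext i
    simp [hB, hE]
    tauto
  have huv : u + restrict E h = h := by
    rw [hu, ← hcompl, restrict_add_restrict_compl]
  have hAv : A.toEuclideanLin (restrict E h) = -A.toEuclideanLin u := by
    rw [eq_neg_iff_add_eq_zero, ← map_add, add_comm, huv, hAh]
  obtain ⟨D, hDE, hDc, w, hwD, hwn, hφ⟩ := exists_sparse_le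
    ((innerₛₗ ℝ (A.toEuclideanLin u)).comp A.toEuclideanLin) h E (l - B.card)
    (fun i hi => not_lt.1 (Finset.mem_filter.1 hi).2) (by
      rw [Nat.cast_sub hBl, sub_mul]
      linarith)
  have hφ' : inner ℝ (A.toEuclideanLin u) (A.toEuclideanLin w) ≤
      -‖A.toEuclideanLin u‖ ^ 2 := by
    simpa [hAv] using hφ
  have hdisj : Disjoint (S ∪ B) D := by
    refine Finset.disjoint_left.2 fun i hi hi' => ?_
    have := hDE hi'
    rw [← hcompl] at this
    exact (Finset.mem_compl.1 this) hi
  have hcard : (S ∪ B).card + D.card ≤ k + l := by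
    rw [Finset.card_union_of_disjoint hSB]
    omega
  have hu0 : ∀ i ∉ S ∪ B, u i = 0 := fun i hi => by rw [hu, restrict_apply, if_neg hi]
  -- In the difference of these two inequalities `‖A w‖²` cancels and `4 σ (‖A u‖² + ⟪A u, A w⟫) ≤
  -- 0` remains.
  have h1 := (ricBounds_smul_add_smul hδ hdisj hcard hu0 hwD (1 - σ) (-σ)).2
  have h2 := (ricBounds_smul_add_smul hδ hdisj hcard hu0 hwD (1 + σ) σ).1
  have hself := ricBounds_smul_add_smul hδ hdisj hcard hu0 hwD 1 0
  have hCS : R ^ 2 ≤ k * ‖u‖ ^ 2 := by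
    refine (sq_sum_abs_le S h).trans ?_
    rw [hS, hu, norm_sq_restrict, norm_sq_restrict]
    gcongr
    exact Finset.subset_union_left
  set X := ‖u‖ ^ 2
  set Y := ‖w‖ ^ 2
  set I := inner ℝ (A.toEuclideanLin u) (A.toEuclideanLin w)
  have hX : 0 < X := by
    by_contra! hX
    nlinarith [sq_pos_of_pos hRpos]
  have hδ0 : 0 ≤ δ := by
    have := hself.1.trans hself.2
    by_contra! hneg
    nlinarith
  have hY : σ ^ 2 * Y ≤ (1 - σ ^ 2) * X := by
    have hY1 : Y ≤ l * β ^ 2 := hwn.trans (by gcongr; omega)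
    have hY2 : l * Y ≤ k * X := by
      calc l * Y ≤ l * (l * β ^ 2) := by gcongr
        _ = (l * β) ^ 2 := by ring
        _ ≤ k * X := by rw [hlβ]; exact hCS
    have hs : σ ^ 2 * k = (1 - σ ^ 2) * l := by linarith
    have hmul := mul_le_mul_of_nonneg_left hY2 (sq_nonneg σ)
    have : l * (σ ^ 2 * Y) ≤ l * ((1 - σ ^ 2) * X) := by
      calc l * (σ ^ 2 * Y) = σ ^ 2 * (l * Y) := by ring
        _ ≤ σ ^ 2 * (k * X) := hmul
        _ = (σ ^ 2 * k) * X := by ring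
        _ = l * ((1 - σ ^ 2) * X) := by rw [hs]; ring
    exact le_of_mul_le_mul_left this hl'
  have hσI := mul_le_mul_of_nonneg_left hφ' hσ.le
  -- Inserting `hY` bounds the bracket by `4 X`, which forces `σ ≤ δ`.
  have h3 : 4 * σ * X ≤ δ * (2 * (1 + σ ^ 2) * X + 2 * (σ ^ 2 * Y)) := by linarith
  have h4 := mul_le_mul_of_nonneg_left hY hδ0
  have h5 := mul_lt_mul_of_pos_right hδσ hX
  linarith

/-! ### Null space property from `δ_k < 1/3` -/

/-- The basic inequality behind the bound `δ_k < 1/3`, for a splitting `k = a + b`. -/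
theorem ric_split_inequality {m : ℕ} {A : Matrix (Fin m) (Fin n) ℝ} {a b : ℕ} (hb : 0 < b)
    {δ : ℝ} (hδ0 : 0 ≤ δ) (hδ : δ ∈ ricBounds A (a + b)) {h : EuclideanSpace ℝ (Fin n)}
    {T E : Finset (Fin n)} (hTE : Disjoint T E) (hT : T.card = a) {R : ℝ}
    (hmax : ∀ i ∈ E, b * |h i| ≤ R) (hsum : ∑ i ∈ E, |h i| ≤ R) :
    (1 - δ) * (a ^ 2 * ‖restrict T h‖ ^ 2) - (1 + δ) * (b ^ 2 * ‖restrict T h‖ ^ 2) -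
        2 * δ * a ^ 2 * b * (R / (a + b)) ^ 2 ≤
      ((a : ℝ) ^ 2 - b ^ 2) * ‖A.toEuclideanLin (restrict T h)‖ ^ 2 + 2 * a * b *
        inner ℝ (A.toEuclideanLin (restrict T h)) (A.toEuclideanLin (restrict E h)) := by
  have hb' : (0 : ℝ) < b := by exact_mod_cast hb
  have hk' : (0 : ℝ) < a + b := by positivity
  have hbR : b * (R / b) = R := by field_simp
  obtain ⟨D, hDE, hDc, w, hwD, hwn, hφ⟩ := exists_sparse_le
    ((innerₛₗ ℝ (A.toEuclideanLin (restrict T h))).comp A.toEuclideanLin) h E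
    (β := R / b) b
    (fun i hi => by
      rw [le_div_iff₀ hb', mul_comm]
      exact hmax i hi) (by rwa [hbR])
  have hφ' : inner ℝ (A.toEuclideanLin (restrict T h)) (A.toEuclideanLin w) ≤
      inner ℝ (A.toEuclideanLin (restrict T h)) (A.toEuclideanLin (restrict E h)) := by
    simpa using hφ
  have hdisj : Disjoint T D := Finset.disjoint_of_subset_right hDE hTE
  have hcard : T.card + D.card ≤ a + b := by omega
  have hu0 : ∀ i ∉ T, restrict T h i = 0 := fun i hi => by rw [restrict_apply, if_neg hi]
  -- The coefficients `±a c` of `w` make `‖A w‖²` cancel between `h1` and `h2`; the cross terms add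
  -- up to `2 a c (a + b) = 2 a b` times the inner product.
  set c : ℝ := b / (a + b) with hc
  have hck : c * (a + b) = b := by rw [hc]; field_simp
  have h1 := (ricBounds_smul_add_smul hδ hdisj hcard hu0 hwD a (a * c)).1
  have h2 := (ricBounds_smul_add_smul hδ hdisj hcard hu0 hwD b (-(a * c))).2
  have hw2 : c ^ 2 * ‖w‖ ^ 2 ≤ b * (R / (a + b)) ^ 2 := by
    calc c ^ 2 * ‖w‖ ^ 2 ≤ c ^ 2 * (b * (R / b) ^ 2) := by gcongr
      _ = b * (R / (a + b)) ^ 2 := by rw [hc]; field_simp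
  have h3 := mul_le_mul_of_nonneg_left hw2 (by positivity : 0 ≤ 2 * δ * (a : ℝ) ^ 2)
  have h4 := mul_le_mul_of_nonneg_left hφ' (by positivity : 0 ≤ 2 * (a : ℝ) * b)
  set I := inner ℝ (A.toEuclideanLin (restrict T h)) (A.toEuclideanLin w)
  have h5 : 2 * ((a : ℝ) * (a * c)) * I + 2 * (b * (a * c)) * I = 2 * a * b * I := by
    rw [← add_mul]
    congr 1
    linear_combination 2 * (a : ℝ) * hck
  linarith

/-- The numerical core of the bound `δ_k < 1/3`. -/
theorem third_le_of_split_inequalities {a b k δ N X Y I U V t : ℝ} (ha : 1 ≤ a)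
    (hab : a = b ∨ b = a + 1) (hk : a + b = k) (hN : 0 < N) (hδ : 0 ≤ δ) (hUV : U + V = N)
    (h1 : (1 - δ) * (a ^ 2 * U) - (1 + δ) * (b ^ 2 * U) - 2 * δ * a ^ 2 * b * t ≤
      (a ^ 2 - b ^ 2) * X + 2 * a * b * -(X + I))
    (h2 : (1 - δ) * (b ^ 2 * V) - (1 + δ) * (a ^ 2 * V) - 2 * δ * b ^ 2 * a * t ≤
      (b ^ 2 - a ^ 2) * Y + 2 * b * a * -(I + Y))
    (hT : k * ((a ^ 2 - b ^ 2) * (X + I - U)) ≤ a * ((a ^ 2 - b ^ 2) * (X + 2 * I + Y - N)))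
    (ht : k * t ≤ N) (hQ : (1 - δ) * N ≤ X + 2 * I + Y) : 1 / 3 ≤ δ := by
  subst hk
  obtain rfl : V = N - U := by linarith
  obtain ⟨Q, rfl⟩ : ∃ Q, Y = Q - X - 2 * I := ⟨X + 2 * I + Y, by ring⟩
  have hb : 1 ≤ b := by rcases hab with h | h <;> linarith
  have ht2 := mul_le_mul_of_nonneg_left ht (by positivity : 0 ≤ 2 * δ * (a * b))
  have hT' : (a - b) * (a + b) * (X + I - U) ≤ a * (a - b) * (Q - N) := by
    refine le_of_mul_le_mul_left (a := a + b) ?_ (by linarith)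
    linarith
  -- The sum of `h1` and `h2`, with `Q = ‖A u‖²`. The term in `X + I - U`, which depends on the
  -- chosen half, is removed by `hT'`, using `2 a (a - b) - (a² - b²) = (a - b)²`.
  have h3 : -δ * (a + b) ^ 2 * N ≤ (a - b) ^ 2 * (Q - N) - 2 * a * b * Q := by linarith
  -- The sign needed to insert `Q ≥ (1 - δ) N`; this is where an almost equal splitting matters.
  have hd : 0 ≤ 2 * a * b - (a - b) ^ 2 := by
    rcases hab with rfl | rfl
    · nlinarith
    · nlinarith
  have h4 : (1 - δ) * N * (2 * a * b - (a - b) ^ 2) ≤ Q * (2 * a * b - (a - b) ^ 2) :=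
    mul_le_mul_of_nonneg_right (by linarith) hd
  have h5 : 1 * (2 * (a * b * N)) ≤ 3 * δ * (2 * (a * b * N)) := by linarith
  have h6 := le_of_mul_le_mul_right h5 (by positivity)
  linarith

/-- The null space property of order `k ≥ 2` follows from `δ_k < 1/3`. -/
theorem sum_abs_lt_sum_compl_of_lt_third {m : ℕ} {A : Matrix (Fin m) (Fin n) ℝ} {k : ℕ}
    (hk : 2 ≤ k) {δ : ℝ} (hδ : δ ∈ ricBounds A k) (hδ3 : δ < 1 / 3)
    {h : EuclideanSpace ℝ (Fin n)} (hAh : A.toEuclideanLin h = 0) (hne : h ≠ 0)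
    {S : Finset (Fin n)} (hS : S.card = k) :
    ∑ i ∈ S, |h i| < ∑ i ∈ Sᶜ, |h i| := by
  by_contra! hle'
  -- Passing to the `k` largest entries keeps the reverse inequality and bounds every other entry by
  -- `R / k`.
  obtain ⟨V, -, hVk, hVtop⟩ := exists_subset_card_eq_forall_le (fun i => |h i|) Finset.univ
    (show k ≤ (Finset.univ : Finset (Fin n)).card from hS ▸ Finset.card_le_univ S)
  have hVtop' : ∀ i ∈ V, ∀ j ∉ V, |h j| ≤ |h i| := fun i hi j hj => hVtop i hi j (by simp [hj])
  have hle : ∑ i ∈ Vᶜ, |h i| ≤ ∑ i ∈ V, |h i| := by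
    have h1 := sum_le_sum_of_forall_le (fun i => |h i|) (hS.trans hVk.symm) hVtop'
    have h2 := Finset.sum_add_sum_compl S fun i => |h i|
    have h3 := Finset.sum_add_sum_compl V fun i => |h i|
    linarith
  set R : ℝ := ∑ i ∈ V, |h i| with hR
  have hRpos : 0 < R := sum_abs_pos_of_sum_compl_le hne hle
  have hmax : ∀ i ∈ Vᶜ, k * |h i| ≤ R := fun i hi => by
    rw [← hVk, ← nsmul_eq_mul]
    exact Finset.card_nsmul_le_sum _ _ _ fun j hj => hVtop' j hj i (Finset.mem_compl.1 hi)
  set a := k / 2 with ha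
  set b := k - a with hb
  have hab : a + b = k := by omega
  have hba : b + a = k := by omega
  have habR : (a : ℝ) + b = k := by exact_mod_cast hab
  have hk' : (0 : ℝ) < k := by exact_mod_cast (by omega : 0 < k)
  set u := restrict V h with hu
  have hself := hδ u ((zeroNorm_le_card fun i hi => by rw [hu, restrict_apply, if_neg hi]).trans
    hVk.le)
  have hCS : R ^ 2 ≤ k * ‖u‖ ^ 2 := hVk ▸ sq_sum_abs_le V h
  have hN : 0 < ‖u‖ ^ 2 := by
    by_contra! hX
    nlinarith [sq_pos_of_pos hRpos]
  have hδ0 : 0 ≤ δ := by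
    have := hself.1.trans hself.2
    by_contra! hneg
    nlinarith
  have hAv : A.toEuclideanLin (restrict Vᶜ h) = -A.toEuclideanLin u := by
    rw [eq_neg_iff_add_eq_zero, ← map_add, add_comm, restrict_add_restrict_compl, hAh]
  -- For odd `k` the halves differ in size and the two split inequalities leave a term proportional
  -- to `a² - b²`. A `T` on which its summands have at most average value replaces averaging over
  -- all halves; for even `k` the summands vanish.
  obtain ⟨T, hTV, hTa, hTf⟩ := exists_subset_card_eq_sum_le
    (fun i => ((a : ℝ) ^ 2 - b ^ 2) * (h i * inner ℝ (A.toEuclideanLin (EuclideanSpace.single i 1))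
      (A.toEuclideanLin u) - h i ^ 2)) V (show a ≤ V.card by omega)
  have hlin : ∀ U : Finset (Fin n), ∑ i ∈ U, ((a : ℝ) ^ 2 - b ^ 2) *
      (h i * inner ℝ (A.toEuclideanLin (EuclideanSpace.single i 1)) (A.toEuclideanLin u) - h i ^ 2)
      = ((a : ℝ) ^ 2 - b ^ 2) * (inner ℝ (A.toEuclideanLin u) (A.toEuclideanLin (restrict U h)) -
        ‖restrict U h‖ ^ 2) := fun U => by
    have := linearMap_eq_sum ((innerₛₗ ℝ (A.toEuclideanLin u)).comp A.toEuclideanLin)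
      (restrict U h)
    simp only [LinearMap.comp_apply, innerₛₗ_apply_apply, restrict_apply, ite_mul, zero_mul,
      Finset.sum_ite_mem, Finset.univ_inter] at this
    rw [this, norm_sq_restrict, ← Finset.mul_sum, Finset.sum_sub_distrib]
    simp only [real_inner_comm]
  rw [hlin, hlin, hVk, ← hu, real_inner_self_eq_norm_sq] at hTf
  have hdisj : ∀ U ⊆ V, Disjoint U Vᶜ := fun U hU =>
    Finset.disjoint_of_subset_left hU disjoint_compl_right
  have hsc : ∀ c : ℕ, c ≤ k → ∀ i ∈ Vᶜ, c * |h i| ≤ R := fun c hc i hi =>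
    le_trans (by gcongr) (hmax i hi)
  have h1 := ric_split_inequality (a := a) (b := b) (by omega) hδ0 (hab ▸ hδ) (hdisj T hTV) hTa
    (hsc b (by omega)) hle
  have h2 := ric_split_inequality (a := b) (b := a) (by omega) hδ0 (hba ▸ hδ)
    (hdisj (V \ T) Finset.sdiff_subset) (by rw [Finset.card_sdiff_of_subset hTV]; omega)
    (hsc a (by omega)) hle
  have hsumv := restrict_add_restrict_sdiff hTV h
  have hNsum : ‖restrict T h‖ ^ 2 + ‖restrict (V \ T) h‖ ^ 2 = ‖u‖ ^ 2 := by
    rw [hu, norm_sq_restrict, norm_sq_restrict, norm_sq_restrict, add_comm]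
    exact Finset.sum_sdiff hTV
  have hAsum : A.toEuclideanLin u =
      A.toEuclideanLin (restrict T h) + A.toEuclideanLin (restrict (V \ T) h) := by
    rw [hu, ← hsumv, map_add]
  rw [hAv, inner_neg_right] at h1 h2
  rw [habR] at h1
  rw [add_comm (b : ℝ), habR] at h2
  have hα : k * (R / k) ^ 2 ≤ ‖u‖ ^ 2 := by
    rw [div_pow, ← mul_div_assoc, div_le_iff₀ (by positivity)]
    nlinarith
  have hQ := hself.1
  set x := A.toEuclideanLin (restrict T h)
  set y := A.toEuclideanLin (restrict (V \ T) h)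
  set Q := ‖A.toEuclideanLin u‖ ^ 2 with hQdef
  set N := ‖u‖ ^ 2
  have hQe : Q = ‖x‖ ^ 2 + 2 * inner ℝ x y + ‖y‖ ^ 2 := by
    rw [hQdef, hAsum, norm_add_sq_real]
  rw [hAsum, inner_add_right, real_inner_self_eq_norm_sq] at h1
  rw [hAsum, inner_add_right, real_inner_self_eq_norm_sq, real_inner_comm] at h2
  rw [hAsum, inner_add_left, real_inner_self_eq_norm_sq, real_inner_comm] at hTf
  rw [hQe] at hTf hQ
  have habd : (a : ℝ) = b ∨ (b : ℝ) = a + 1 := by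
    have : a = b ∨ b = a + 1 := by omega
    exact_mod_cast this
  have ha1 : (1 : ℝ) ≤ a := by exact_mod_cast (by omega : 1 ≤ a)
  exact absurd (third_le_of_split_inequalities ha1 habd habR hN hδ0 hNsum h1 h2 hTf hα hQ)
    (not_le.2 hδ3)

/-! ### The partial regularizer near a point -/

theorem exists_partialReg_eq (φ : ℝ → ℝ) {r : ℕ} (hr : r ≤ n) (x : EuclideanSpace ℝ (Fin n)) :
    ∃ T : Finset (Fin n), T.card = r ∧ partialReg φ r x = ∑ i ∈ Tᶜ, φ |x i| ∧
      ∀ i ∈ T, ∀ j ∉ T, |x j| ≤ |x i| := by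
  set τ := Tuple.sort fun j => -|x j| with hτ
  refine ⟨(Finset.univ.filter fun i : Fin n => i.val < r).map τ.toEmbedding, ?_, ?_, ?_⟩
  · rw [Finset.card_map, Fin.card_filter_val_lt, min_eq_right hr]
  · have : ((Finset.univ.filter fun i : Fin n => i.val < r).map τ.toEmbedding)ᶜ =
        (Finset.univ.filter fun i : Fin n => r ≤ i.val).map τ.toEmbedding := by
      ext i
      obtain ⟨j, rfl⟩ := τ.surjective i
      simp
    rw [this, Finset.sum_map]
    rfl
  · intro i hi j hj
    obtain ⟨i, rfl⟩ := τ.surjective i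
    obtain ⟨j, rfl⟩ := τ.surjective j
    simp only [Finset.mem_map_equiv, Equiv.symm_apply_apply, Finset.mem_filter, Finset.mem_univ,
      true_and, not_lt] at hi hj
    exact antitone_absOrd x (show i ≤ j from Fin.le_def.2 (by omega))

/-- Dropping the `r` largest entries leaves the least possible sum. This lets the set `T` attached
to `y` also serve as a bound at `x`. -/
theorem partialReg_le_sum_compl {q : ℝ} (hq : 0 ≤ q) {r : ℕ} (x : EuclideanSpace ℝ (Fin n))
    {U : Finset (Fin n)} (hU : U.card = r) :
    partialReg (fun t => |t| ^ q) r x ≤ ∑ i ∈ Uᶜ, |x i| ^ q := by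
  obtain ⟨T, hTr, hT, htop⟩ := exists_partialReg_eq (fun t => |t| ^ q)
    (show r ≤ n by simpa [hU] using Finset.card_le_univ U) x
  have h1 := sum_le_sum_of_forall_le (fun i => |x i| ^ q) (hU.trans hTr.symm) fun i hi j hj =>
    Real.rpow_le_rpow (abs_nonneg _) (htop i hi j hj) hq
  have h2 := Finset.sum_add_sum_compl T fun i => |x i| ^ q
  have h3 := Finset.sum_add_sum_compl U fun i => |x i| ^ q
  simp only [abs_abs] at hT
  linarith

/-- Near `x`, the regularizer is governed by an `r`-element subset of the support of `x`. -/
theorem exists_partialReg_sub_ge {q : ℝ} (hq : 0 < q) {r : ℕ} (x : EuclideanSpace ℝ (Fin n))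
    {S : Finset (Fin n)} (hS : ∀ i, i ∈ S ↔ x i ≠ 0) (hr : r ≤ S.card) {μ : ℝ}
    (hμ : ∀ i ∈ S, μ ≤ |x i|) {y : EuclideanSpace ℝ (Fin n)} (hy : ‖y - x‖ < μ / 2) :
    ∃ T ⊆ S, T.card = r ∧ ∑ i ∈ S \ T, (|y i| ^ q - |x i| ^ q) + ∑ i ∈ Sᶜ, |(y - x) i| ^ q ≤
      partialReg (fun t => |t| ^ q) r y - partialReg (fun t => |t| ^ q) r x := by
  obtain ⟨T, hTr, hT, htop⟩ := exists_partialReg_eq (fun t => |t| ^ q)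
    (hr.trans (by simpa using Finset.card_le_univ S)) y
  have hcoord : ∀ i, |y i - x i| < μ / 2 := fun i =>
    (PiLp.norm_apply_le (y - x) i).trans_lt hy
  have hx0 : ∀ i ∉ S, x i = 0 := fun i hi => by simpa using (hS i).not.1 hi
  -- Entries of `y` are above `μ / 2` on `S` and below it off `S`. A top position off `S` would
  -- leave out some position of `S`, since `r ≤ |S|`.
  have hTS : T ⊆ S := by
    intro j hj
    by_contra hjS
    obtain ⟨i, hiS, hiT⟩ : ∃ i ∈ S, i ∉ T := by
      by_contra! hsub
      have h1 := Finset.card_lt_card ⟨hsub, fun h => hjS (h hj)⟩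
      omega
    have h1 := htop j hj i hiT
    have h2 := hcoord j
    rw [hx0 j hjS, sub_zero] at h2
    have h3 := hcoord i
    have h4 := hμ i hiS
    have h5 := abs_sub_abs_le_abs_sub (x i) (y i)
    rw [abs_sub_comm] at h5
    linarith
  refine ⟨T, hTS, hTr, ?_⟩
  have h1 := partialReg_le_sum_compl hq.le x hTr
  simp only [abs_abs] at hT
  have hdec : ∀ f : Fin n → ℝ, ∑ i ∈ Tᶜ, f i = ∑ i ∈ S \ T, f i + ∑ i ∈ Sᶜ, f i := fun f => by
    have e1 := Finset.sum_add_sum_compl T f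
    have e2 := Finset.sum_add_sum_compl S f
    have e3 := Finset.sum_sdiff (f := f) hTS
    linarith
  have h2 : ∑ i ∈ Sᶜ, |x i| ^ q = 0 := Finset.sum_eq_zero fun i hi => by
    rw [hx0 i (Finset.mem_compl.1 hi), abs_zero, Real.zero_rpow hq.ne']
  have h3 : ∑ i ∈ Sᶜ, |(y - x) i| ^ q = ∑ i ∈ Sᶜ, |y i| ^ q :=
    Finset.sum_congr rfl fun i hi => by simp [hx0 i (Finset.mem_compl.1 hi)]
  rw [hdec, h2] at h1
  rw [hT, hdec, Finset.sum_sub_distrib, h3]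
  linarith

theorem exists_pos_le_abs (x : EuclideanSpace ℝ (Fin n)) {S : Finset (Fin n)}
    (hS : ∀ i ∈ S, x i ≠ 0) : ∃ μ > 0, ∀ i ∈ S, μ ≤ |x i| := by
  rcases S.eq_empty_or_nonempty with rfl | hne
  · exact ⟨1, one_pos, by simp⟩
  · obtain ⟨p, hp, hmin⟩ := Finset.exists_min_image S (fun i => |x i|) hne
    exact ⟨|x p|, abs_pos.2 (hS p hp), hmin⟩

/-! ### Kernel vectors and the support of a sparsest solution -/

/-- No kernel vector other than `0` is supported in the support of a sparsest solution. -/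
theorem IsSparsest.eq_zero_of_ker {m : ℕ} {A : Matrix (Fin m) (Fin n) ℝ}
    {b : EuclideanSpace ℝ (Fin m)} {x : EuclideanSpace ℝ (Fin n)} (hx : IsSparsest A b x)
    {h : EuclideanSpace ℝ (Fin n)} (hAh : A.toEuclideanLin h = 0)
    (hsupp : ∀ i, x i = 0 → h i = 0) : h = 0 := by
  by_contra hne
  obtain ⟨j, hj⟩ : ∃ j, h j ≠ 0 := by
    by_contra! hc
    exact hne (by ext i; simp [hc i])
  -- The multiple of `h` is chosen to cancel entry `j` without creating new nonzero entries, giving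
  -- a sparser solution.
  have hle := hx.2 (x - (x j / h j) • h) (by rw [map_sub, map_smul, hAh, hx.1]; simp)
  refine absurd hle (not_le.2 (Finset.card_lt_card ⟨fun i hi => ?_, fun hsub => ?_⟩))
  · simp only [Finset.mem_filter, Finset.mem_univ, true_and] at hi ⊢
    intro h0
    exact hi (by simp [h0, hsupp i h0])
  · have hmem : j ∈ Finset.univ.filter fun i => x i ≠ 0 := by
      simpa using fun h0 => hj (hsupp j h0)
    exact (Finset.mem_filter.1 (hsub hmem)).2 (by simp [hj])

/-- The map `h ↦ (A h, h` restricted to `Sᶜ)` is injective by `IsSparsest.eq_zero_of_ker`, hence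
bounded below in finite dimension. -/
theorem IsSparsest.exists_sum_le_mul_sum_compl {m : ℕ} {A : Matrix (Fin m) (Fin n) ℝ}
    {b : EuclideanSpace ℝ (Fin m)} {x : EuclideanSpace ℝ (Fin n)} (hx : IsSparsest A b x)
    {S : Finset (Fin n)} (hS : ∀ i, i ∈ S ↔ x i ≠ 0) :
    ∃ M : ℝ, 0 ≤ M ∧ ∀ h : EuclideanSpace ℝ (Fin n), A.toEuclideanLin h = 0 →
      ∑ i ∈ S, |h i| ≤ M * ∑ i ∈ Sᶜ, |h i| := by
  let P : EuclideanSpace ℝ (Fin n) →ₗ[ℝ] Fin n → ℝ :=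
    { toFun := fun h i => restrict Sᶜ h i
      map_add' := fun u v => by
        ext i
        by_cases hi : i ∈ S <;> simp [hi]
      map_smul' := fun c v => by
        ext i
        by_cases hi : i ∈ S <;> simp [hi] }
  let L := A.toEuclideanLin.prod P
  have hker : LinearMap.ker L = ⊥ := by
    rw [LinearMap.ker_eq_bot']
    intro h hL
    have h1 : A.toEuclideanLin h = 0 := congrArg Prod.fst hL
    have h2 : P h = 0 := congrArg Prod.snd hL
    refine hx.eq_zero_of_ker h1 fun i hi => ?_
    have hiS : i ∉ S := fun hmem => (hS i).1 hmem hi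
    simpa [P, hiS] using congrFun h2 i
  obtain ⟨C, -, hC⟩ := L.exists_antilipschitzWith hker
  refine ⟨S.card * C, by positivity, fun h hAh => ?_⟩
  have hnorm : ‖h‖ ≤ C * ‖L h‖ := by simpa using hC.le_mul_dist h 0
  have hL : ‖L h‖ ≤ ∑ i ∈ Sᶜ, |h i| := by
    have hnn : 0 ≤ ∑ i ∈ Sᶜ, |h i| := Finset.sum_nonneg fun i _ => abs_nonneg _
    refine max_le ?_ ?_
    · simpa [L, hAh] using hnn
    · refine (pi_norm_le_iff_of_nonneg hnn).2 fun i => ?_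
      by_cases hi : i ∈ S
      · simpa [L, P, hi] using hnn
      · simpa [L, P, hi] using Finset.single_le_sum (f := fun i => |h i|)
          (fun i _ => abs_nonneg _) (Finset.mem_compl.2 hi)
  calc ∑ i ∈ S, |h i| ≤ ∑ _i ∈ S, ‖h‖ :=
        Finset.sum_le_sum fun i _ => PiLp.norm_apply_le h i
    _ = S.card * ‖h‖ := by rw [Finset.sum_const, nsmul_eq_mul]
    _ ≤ S.card * (C * ∑ i ∈ Sᶜ, |h i|) := by gcongr; exact hnorm.trans (by gcongr)
    _ = S.card * C * ∑ i ∈ Sᶜ, |h i| := by ring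

theorem IsSparsest.sum_compl_pos {m : ℕ} {A : Matrix (Fin m) (Fin n) ℝ}
    {b : EuclideanSpace ℝ (Fin m)} {x : EuclideanSpace ℝ (Fin n)} (hx : IsSparsest A b x)
    {S : Finset (Fin n)} (hS : ∀ i, i ∈ S ↔ x i ≠ 0) {h : EuclideanSpace ℝ (Fin n)}
    (hAh : A.toEuclideanLin h = 0) (hne : h ≠ 0) : 0 < ∑ i ∈ Sᶜ, |h i| := by
  by_contra! hle
  have hz := (Finset.sum_eq_zero_iff_of_nonneg fun i _ => abs_nonneg (h i)).1
    (le_antisymm hle (Finset.sum_nonneg fun i _ => abs_nonneg (h i)))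
  refine hne (hx.eq_zero_of_ker hAh fun i hi => ?_)
  exact abs_eq_zero.1 (hz i (Finset.mem_compl.2 fun hmem => (hS i).1 hmem hi))

/-! ### Local minimality for `q < 1` and `q = 1` -/

/-- After scaling by `t` this is `1 - z ≤ (1 - z) ^ q` for `z = s / t` in `[0, 1)`. It bounds the
loss on the support linearly. -/
theorem rpow_sub_mul_le_rpow_sub {q s t : ℝ} (hq1 : q ≤ 1) (hs : 0 ≤ s) (hst : s < t) :
    t ^ q - t ^ (q - 1) * s ≤ (t - s) ^ q := by
  have ht : 0 < t := hs.trans_lt hst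
  have hz0 : 0 < 1 - s / t := by rw [sub_pos, div_lt_one ht]; exact hst
  have hz1 : 1 - s / t ≤ 1 := by
    have := div_nonneg hs ht.le
    linarith
  have h1 := Real.rpow_le_rpow_of_exponent_ge hz0 hz1 hq1
  rw [Real.rpow_one] at h1
  have h2 : t - s = t * (1 - s / t) := by field_simp
  rw [h2, Real.mul_rpow ht.le hz0.le, Real.rpow_sub_one ht.ne']
  have h3 := mul_le_mul_of_nonneg_left h1 (Real.rpow_nonneg ht.le q)
  refine le_trans (le_of_eq ?_) h3
  ring

/-- For `q < 1` a sparsest solution is a strict local minimizer without further assumptions. -/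
theorem IsSparsest.isStrictLocalMinimizer_of_lt_one {m : ℕ} {A : Matrix (Fin m) (Fin n) ℝ}
    {b : EuclideanSpace ℝ (Fin m)} {x : EuclideanSpace ℝ (Fin n)} (hx : IsSparsest A b x)
    {q : ℝ} (hq0 : 0 < q) (hq1 : q < 1) {r : ℕ} (hr : r ≤ zeroNorm x) :
    IsStrictLocalMinimizer A b (fun t => |t| ^ q) r x := by
  set S : Finset (Fin n) := Finset.univ.filter fun i => x i ≠ 0 with hSdef
  have hS : ∀ i, i ∈ S ↔ x i ≠ 0 := by simp [hSdef]
  obtain ⟨M, hM0, hM⟩ := hx.exists_sum_le_mul_sum_compl hS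
  obtain ⟨μ, hμ0, hμ⟩ := exists_pos_le_abs x fun i hi => (hS i).1 hi
  set C : ℝ := μ ^ (q - 1) with hC
  have hC0 : 0 ≤ C := Real.rpow_nonneg hμ0.le _
  have hCM : 0 < C * M + 1 := by positivity
  -- Chosen so that `|h i| ≤ e` gives `|h i| ^ q ≥ (C M + 1) |h i|`: the part `C M` pays for the
  -- loss on `S`, and the extra `1` makes the inequality strict.
  set e : ℝ := (C * M + 1) ^ (q - 1)⁻¹ with he
  have he0 : 0 < e := Real.rpow_pos_of_pos hCM _
  have heq : e ^ (q - 1) = C * M + 1 := by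
    rw [he, ← Real.rpow_mul hCM.le, inv_mul_cancel₀ (by linarith), Real.rpow_one]
  refine ⟨hx.1, min (μ / 2) e, by positivity, fun y hy hyx hlt => ?_⟩
  obtain ⟨T, hTS, -, hT⟩ := exists_partialReg_sub_ge hq0 x hS hr hμ
    (hlt.trans_le (min_le_left _ _))
  set h := y - x with hh
  have hAh : A.toEuclideanLin h = 0 := by rw [hh, map_sub, hy, hx.1, sub_self]
  have hpos := hx.sum_compl_pos hS hAh (sub_ne_zero.2 hyx)
  have hcoord : ∀ i, |h i| < min (μ / 2) e := fun i => (PiLp.norm_apply_le h i).trans_lt hlt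
  have h1 : -(C * ∑ i ∈ S, |h i|) ≤ ∑ i ∈ S \ T, (|y i| ^ q - |x i| ^ q) := by
    calc -(C * ∑ i ∈ S, |h i|) ≤ -(C * ∑ i ∈ S \ T, |h i|) := by
          gcongr
          exact Finset.sdiff_subset
      _ = ∑ i ∈ S \ T, -(C * |h i|) := by rw [Finset.mul_sum, Finset.sum_neg_distrib]
      _ ≤ ∑ i ∈ S \ T, (|y i| ^ q - |x i| ^ q) := Finset.sum_le_sum fun i hi => by
          have hxi := hμ i (Finset.mem_sdiff.1 hi).1
          have hhi := (hcoord i).trans_le (min_le_left _ _)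
          have h2 := rpow_sub_mul_le_rpow_sub hq1.le (abs_nonneg (h i))
            (show |h i| < |x i| by linarith)
          have h3 : |x i| - |h i| ≤ |y i| := by
            have := abs_sub_abs_le_abs_sub (x i) (y i)
            rw [abs_sub_comm] at this
            have e : |h i| = |y i - x i| := rfl
            linarith
          have h4 := Real.rpow_le_rpow (by linarith) h3 hq0.le
          have h5 : |x i| ^ (q - 1) * |h i| ≤ C * |h i| :=
            mul_le_mul_of_nonneg_right
              (Real.rpow_le_rpow_of_nonpos hμ0 hxi (by linarith)) (abs_nonneg _)
          linarith
  have h2 : (C * M + 1) * ∑ i ∈ Sᶜ, |h i| ≤ ∑ i ∈ Sᶜ, |h i| ^ q := by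
    rw [Finset.mul_sum]
    refine Finset.sum_le_sum fun i _ => ?_
    rcases (abs_nonneg (h i)).eq_or_lt with h0 | h0
    · rw [← h0, Real.zero_rpow hq0.ne', mul_zero]
    · have h3 := Real.rpow_le_rpow_of_nonpos h0 ((hcoord i).le.trans (min_le_right _ _))
        (show q - 1 ≤ 0 by linarith)
      rw [heq, Real.rpow_sub_one h0.ne', le_div_iff₀ h0] at h3
      exact h3
  have h3 := mul_le_mul_of_nonneg_left (hM h hAh) hC0
  linarith

/-- For `q = 1` a null space property outside of `r`-element subsets of the support suffices. -/
theorem IsSparsest.isStrictLocalMinimizer_of_eq_one {m : ℕ} {A : Matrix (Fin m) (Fin n) ℝ}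
    {b : EuclideanSpace ℝ (Fin m)} {x : EuclideanSpace ℝ (Fin n)} (hx : IsSparsest A b x)
    {S : Finset (Fin n)} (hS : ∀ i, i ∈ S ↔ x i ≠ 0) {r : ℕ} (hr : r ≤ S.card)
    (hnsp : ∀ h, A.toEuclideanLin h = 0 → h ≠ 0 → ∀ T ⊆ S, T.card = r →
      ∑ i ∈ S \ T, |h i| < ∑ i ∈ Sᶜ, |h i|) :
    IsStrictLocalMinimizer A b (fun t => |t| ^ (1 : ℝ)) r x := by
  obtain ⟨μ, hμ0, hμ⟩ := exists_pos_le_abs x fun i hi => (hS i).1 hi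
  refine ⟨hx.1, μ / 2, by positivity, fun y hy hyx hlt => ?_⟩
  obtain ⟨T, hTS, hTr, hT⟩ := exists_partialReg_sub_ge one_pos x hS hr hμ hlt
  have h1 := hnsp (y - x) (by rw [map_sub, hy, hx.1, sub_self]) (sub_ne_zero.2 hyx) T hTS hTr
  have h2 : -∑ i ∈ S \ T, |(y - x) i| ≤ ∑ i ∈ S \ T, (|y i| ^ (1 : ℝ) - |x i| ^ (1 : ℝ)) := by
    rw [← Finset.sum_neg_distrib]
    refine Finset.sum_le_sum fun i _ => ?_
    have := abs_sub_abs_le_abs_sub (x i) (y i)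
    rw [abs_sub_comm] at this
    rw [Real.rpow_one, Real.rpow_one, PiLp.sub_apply]
    linarith
  have h3 : ∑ i ∈ Sᶜ, |(y - x) i| ^ (1 : ℝ) = ∑ i ∈ Sᶜ, |(y - x) i| := by
    simp only [Real.rpow_one]
  linarith

/-! ### Trading half of `T`, and monotonicity of the constants -/

/-- The null space property of order `K - ⌊r/2⌋` gives the one outside of `r`-element subsets. -/
theorem sum_sdiff_lt_of_nsp {h : EuclideanSpace ℝ (Fin n)} {S T : Finset (Fin n)} (hTS : T ⊆ S)
    (hnsp : ∀ U : Finset (Fin n), U.card = S.card - T.card / 2 →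
      ∑ i ∈ U, |h i| < ∑ i ∈ Uᶜ, |h i|) :
    ∑ i ∈ S \ T, |h i| < ∑ i ∈ Sᶜ, |h i| := by
  obtain ⟨V, hVT, hVc, hV⟩ := exists_subset_card_eq_sum_le (fun i => |h i|) T
    (Nat.div_le_self T.card 2)
  have hhalf : 2 * ∑ i ∈ V, |h i| ≤ ∑ i ∈ T, |h i| := by
    rcases Nat.eq_zero_or_pos T.card with h0 | h0
    · have : V = ∅ := by rw [← Finset.card_eq_zero]; omega
      rw [this]
      simpa using Finset.sum_nonneg fun i _ => abs_nonneg (h i)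
    · have h1 : ((T.card / 2 : ℕ) : ℝ) ≤ T.card / 2 := Nat.cast_div_le
      have h2 : (0 : ℝ) ≤ ∑ i ∈ T, |h i| := Finset.sum_nonneg fun i _ => abs_nonneg _
      have h3 := mul_le_mul_of_nonneg_right h1 h2
      have h4 : (0 : ℝ) < T.card := by exact_mod_cast h0
      refine le_of_mul_le_mul_left (?_ : (T.card : ℝ) * _ ≤ T.card * _) h4
      linarith
  -- Here `V` is moved to the other side: `∑_{S \ T} + ∑_{T \ V} < ∑_{Sᶜ} + ∑_V`, and `∑_V ≤ ∑_{T \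
  -- V}` by `hhalf`.
  have hmain := hnsp (S \ V) (by rw [Finset.card_sdiff_of_subset (hVT.trans hTS), hVc])
  have e1 := Finset.sum_sdiff (f := fun i => |h i|) (hVT.trans hTS)
  have e2 := Finset.sum_sdiff (f := fun i => |h i|) hTS
  have e3 := Finset.sum_add_sum_compl S fun i => |h i|
  have e4 := Finset.sum_add_sum_compl (S \ V) fun i => |h i|
  linarith

theorem ricBounds_antitone {m : ℕ} (A : Matrix (Fin m) (Fin n) ℝ) : Antitone (ricBounds A) :=
  fun _ _ hkl _ hδ x hx => hδ x (hx.trans hkl)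

theorem ric_le_ric {m : ℕ} (hn : 0 < n) (A : Matrix (Fin m) (Fin n) ℝ) {k l : ℝ} (hk : 0 < k)
    (hkl : k ≤ l) : ric A k ≤ ric A l :=
  (isLeast_ric hn A hk).2
    (ricBounds_antitone A (Nat.ceil_mono hkl) (isLeast_ric hn A (hk.trans_le hkl)).1)

theorem zeroNorm_le {x : EuclideanSpace ℝ (Fin n)} : zeroNorm x ≤ n := by
  simpa using zeroNorm_le_card (x := x) (S := Finset.univ) (by simp)

theorem minCard_le {m : ℕ} (A : Matrix (Fin m) (Fin n) ℝ) (b : EuclideanSpace ℝ (Fin m)) :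
    minCard A b ≤ n := by
  rcases Set.eq_empty_or_nonempty {k | ∃ x, A.toEuclideanLin x = b ∧ zeroNorm x = k} with h | h
  -- Without solutions the infimum is over the empty set and equals `0`.
  · simp [minCard, h]
  · obtain ⟨x, -, hx⟩ := Nat.sInf_mem h
    rw [minCard, ← hx]
    exact zeroNorm_le

theorem IsSparsest.zeroNorm_eq_minCard {m : ℕ} {A : Matrix (Fin m) (Fin n) ℝ}
    {b : EuclideanSpace ℝ (Fin m)} {x : EuclideanSpace ℝ (Fin n)} (hx : IsSparsest A b x) :
    zeroNorm x = minCard A b := by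
  refine le_antisymm (le_csInf ⟨_, x, hx.1, rfl⟩ ?_) (Nat.sInf_le ⟨x, hx.1, rfl⟩)
  rintro _ ⟨y, hy, rfl⟩
  exact hx.2 y hy

/-- The null space property of order `k` follows from `δ_{γ k} < 1 / √((γ - 1)⁻¹ + 1)`. -/
theorem sum_abs_lt_sum_compl_of_ric_lt {m : ℕ} {A : Matrix (Fin m) (Fin n) ℝ} {k : ℕ}
    (hk : 0 < k) {γ : ℝ} (hγ : 1 < γ) (hric : ric A (γ * k) < 1 / √((γ - 1)⁻¹ + 1)) (hn : 0 < n)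
    {h : EuclideanSpace ℝ (Fin n)} (hAh : A.toEuclideanLin h = 0) (hne : h ≠ 0)
    {S : Finset (Fin n)} (hS : S.card = k) :
    ∑ i ∈ S, |h i| < ∑ i ∈ Sᶜ, |h i| := by
  have hk' : (0 : ℝ) < k := by exact_mod_cast hk
  have hceil := Nat.le_ceil (γ * k)
  obtain ⟨l, hl⟩ : ∃ l, ⌈γ * k⌉₊ = k + l := by
    refine Nat.exists_eq_add_of_le ?_
    have : (k : ℝ) ≤ ⌈γ * k⌉₊ := by nlinarith
    exact_mod_cast this
  rw [hl] at hceil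
  push_cast at hceil
  have hl' : (0 : ℝ) < l := by nlinarith
  have hmem := (isLeast_ric hn A (by positivity : 0 < γ * (k : ℝ))).1
  rw [hl] at hmem
  have hσ : (0 : ℝ) < l / (k + l) := by positivity
  refine sum_abs_lt_sum_compl_of_lt_sqrt hk (by exact_mod_cast hl') (Real.sqrt_pos.2 hσ) ?_ hmem
    (hric.trans_le ?_) hAh hne hS
  · rw [Real.sq_sqrt hσ.le]
    field_simp
  -- Since `l ≥ (γ - 1) k`, the ratio `l / (k + l)` is at least `(γ - 1) / γ`.
  · rw [one_div, ← Real.sqrt_inv]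
    refine Real.sqrt_le_sqrt ?_
    have hγ1 : 0 < γ - 1 := by linarith
    have : ((γ - 1)⁻¹ + 1)⁻¹ = (γ - 1) / γ := by
      field_simp
      ring
    rw [this, div_le_div_iff₀ (by linarith) (by linarith)]
    nlinarith

end PartialReg

theorem theorem4p2 {m n : ℕ} (A : Matrix (Fin m) (Fin n) ℝ) (b : EuclideanSpace ℝ (Fin m))
    (q : ℝ) (hq0 : 0 < q) (hq1 : q ≤ 1) (K r : ℕ) (hK : K = PartialReg.minCard A b)
    (hr : r ≤ K) :
    -- local recovery
    (((PartialReg.ric A ((K - r / 2 : ℕ) : ℝ) < 1 / 3 ∧ ¬ (K = 1 ∧ r = 0 ∧ q = 1)) ∨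
        ∃ γ : ℝ, 1 < γ ∧ PartialReg.ric A (γ * ((K - r / 2 : ℕ) : ℝ)) <
          1 / Real.sqrt ((γ - 1) ^ (1 - 2 / q) + 1)) →
      ∀ x : EuclideanSpace ℝ (Fin n), PartialReg.IsSparsest A b x →
        PartialReg.IsStrictLocalMinimizer A b (fun t => |t| ^ q) r x) ∧
    -- the bounds are implied by the corresponding ones of order `K` and `γ K`
    (PartialReg.ric A (K : ℝ) < 1 / 3 → PartialReg.ric A ((K - r / 2 : ℕ) : ℝ) < 1 / 3) ∧
    (∀ γ : ℝ, 1 < γ →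
      PartialReg.ric A (γ * (K : ℝ)) < 1 / Real.sqrt ((γ - 1) ^ (1 - 2 / q) + 1) →
      PartialReg.ric A (γ * ((K - r / 2 : ℕ) : ℝ)) <
        1 / Real.sqrt ((γ - 1) ^ (1 - 2 / q) + 1)) := by
  have hKn : K ≤ n := hK ▸ PartialReg.minCard_le A b
  have hle : ((K - r / 2 : ℕ) : ℝ) ≤ K := by exact_mod_cast Nat.sub_le K (r / 2)
  refine ⟨fun hcond x hx => ?_, fun h => ?_, fun γ hγ h => ?_⟩
  · have hxK : PartialReg.zeroNorm x = K := hx.zeroNorm_eq_minCard.trans hK.symm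
    rcases hq1.lt_or_eq with hq | rfl
    · exact hx.isStrictLocalMinimizer_of_lt_one hq0 hq (hxK ▸ hr)
    set S : Finset (Fin n) := Finset.univ.filter fun i => x i ≠ 0 with hSdef
    have hS : ∀ i, i ∈ S ↔ x i ≠ 0 := by simp [hSdef]
    have hSK : S.card = K := hxK
    refine hx.isStrictLocalMinimizer_of_eq_one hS (hSK ▸ hr) fun h hAh hne T hTS hTr => ?_
    rcases hr.eq_or_lt with rfl | hrK
    · rw [Finset.eq_of_subset_of_card_le hTS (hSK.trans hTr.symm).le, Finset.sdiff_self,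
        Finset.sum_empty]
      exact hx.sum_compl_pos hS hAh hne
    refine PartialReg.sum_sdiff_lt_of_nsp hTS fun U hU => ?_
    rw [hSK, hTr] at hU
    have hn : 0 < n := by omega
    have hk : 0 < K - r / 2 := by omega
    rcases hcond with ⟨hric, hexc⟩ | ⟨γ, hγ, hric⟩
    · have hmem := (PartialReg.isLeast_ric hn A (by exact_mod_cast hk :
        (0 : ℝ) < ((K - r / 2 : ℕ) : ℝ))).1
      rw [Nat.ceil_natCast] at hmem
      -- With `r < K`, order `1` occurs only for `K = 1`, `r = 0`, which is the excluded case.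
      have hk2 : 2 ≤ K - r / 2 := by
        by_contra hlt
        exact hexc ⟨by omega, by omega, rfl⟩
      exact PartialReg.sum_abs_lt_sum_compl_of_lt_third hk2 hmem hric hAh hne hU
    · have hexp : (γ - 1) ^ (1 - 2 / (1 : ℝ)) = (γ - 1)⁻¹ := by
        rw [← Real.rpow_neg_one]
        norm_num
      rw [hexp] at hric
      exact PartialReg.sum_abs_lt_sum_compl_of_ric_lt hk hγ hric hn hAh hne hU
  -- For `K = 0` both orders are `0`; otherwise `r ≤ K` keeps `K - ⌊r/2⌋` positive, as monotonicity
  -- requires.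
  · rcases Nat.eq_zero_or_pos K with rfl | hK0
    · simpa using h
    · exact (PartialReg.ric_le_ric (by omega) A
        (by exact_mod_cast (by omega : 0 < K - r / 2)) hle).trans_lt h
  · rcases Nat.eq_zero_or_pos K with rfl | hK0
    · simpa using h
    · have hk : (0 : ℝ) < ((K - r / 2 : ℕ) : ℝ) := by exact_mod_cast (by omega : 0 < K - r / 2)
      exact (PartialReg.ric_le_ric (by omega) A (by positivity)
        (mul_le_mul_of_nonneg_left hle (by linarith))).trans_lt h
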